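/- Let $n\ge 1$ and $k\ge 0$ be integers and let $1\le p\le\infty$ (with $1/\infty:=0$). Let $A$ be a regular real $n\times n$ matrix, $\mathbf b\in\mathbb R^n$, and $\varphi(\mathbf x):=A\mathbf x+\mathbf b$. Let $\widehat\Omega\subset\mathbb R^n$ be open (for example a domain) and $\Omega:=\varphi(\widehat\Omega)$. Let $\|A\|$ denote the matrix norm associated with the Euclidean norm. For $v\in W^{k,p}(\Omega)$ (where $W^{0,p}=L^p$) define $$|v|_{k,p,\Omega}:=\Bigl(\sum_{i_1,\dots,i_k=1}^n\int_\Omega\Bigl|\frac{\partial^k v}{\partial x_{i_1}\cdots\partial x_{i_k}}\Bigr|^p\,d\mathbf x\Bigr)^{1/p}\quad(p<\infty),\qquad |v|_{k,\infty,\Omega}:=\max_{i_1,\dots,i_k}\operatorname*{ess\,sup}_{\Omega}\Bigl|\frac{\partial^k v}{\partial x_{i_1}\cdots\partial x_{i_k}}\Bigr|,$$ with derivatives in the sense of distributions; thus the sum has $n^k$ terms, i.e. each multi-index $\delta$ with $|\delta|=k$ is counted $k!/\delta!$ times. Then, for every real-valued $v\in W^{k,p}(\Omega)$, the function $\hat v:=v\circ\varphi$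 belongs to $W^{k,p}(\widehat\Omega)$ and $$n^{-k\mu(p)}\,|\det A|^{1/p}\,\|A\|^{-k}\,|\hat v|_{k,p,\widehat\Omega}\;\le\;|v|_{k,p,\Omega}\;\le\; n^{k\mu(p)}\,|\det A|^{1/p}\,\|A^{-1}\|^{k}\,|\hat v|_{k,p,\widehat\Omega},$$ where $$\mu(p):=\begin{cases}\frac1p-\frac12,&1\le p\le 2,\\[2pt] \frac12-\frac1p,&2\le p\le\infty.\end{cases}$$ Moreover, for $p<\infty$, $\mu(p)=\dfrac{\tau(p)+\gamma(p)}{p}$, where $\tau(p):=1-\frac p2$, $\gamma(p):=0$ for $1\le p\le 2$ and $\tau(p):=0$, $\gamma(p):=\frac p2-1$ for $2\le p<\infty$. -/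

import Mathlib

open MeasureTheory
open scoped ENNReal ContDiff

/-- Euclidean space `ℝⁿ`. -/
abbrev EucSpace (n : ℕ) : Type := EuclideanSpace ℝ (Fin n)

/-- The classical partial derivative `∂_{α 0} ⋯ ∂_{α (m-1)} f` of order `m` of a smooth function,
where `α` lists the `m` coordinate directions. -/
noncomputable def partialDeriv {n m : ℕ} (α : Fin m → Fin n) (f : EucSpace n → ℝ) :
    EucSpace n → ℝ :=
  fun x => iteratedFDeriv ℝ m f x (fun i => EuclideanSpace.single (α i) (1 : ℝ))

/-- `f` is a test function on `Ω`: smooth, with compact support contained in `Ω`. -/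
def IsTestFunction {n : ℕ} (Ω : Set (EucSpace n)) (f : EucSpace n → ℝ) : Prop :=
  ContDiff ℝ ∞ f ∧ HasCompactSupport f ∧ tsupport f ⊆ Ω

/-- `g` is the weak (distributional) derivative `∂_{α 0} ⋯ ∂_{α (m-1)} v` on `Ω`. -/
def HasWeakDeriv {n m : ℕ} (Ω : Set (EucSpace n)) (α : Fin m → Fin n)
    (v g : EucSpace n → ℝ) : Prop :=
  LocallyIntegrableOn v Ω ∧ LocallyIntegrableOn g Ω ∧
    ∀ f : EucSpace n → ℝ, IsTestFunction Ω f →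
      ∫ x in Ω, v x * partialDeriv α f x = (-1) ^ m * ∫ x in Ω, g x * f x

/-- Membership in the Sobolev space `W^{k,p}(Ω)`. (For `m = 0` the weak derivative is `v` itself,
so that `v ∈ L^p(Ω)`.) -/
def MemSobolev {n : ℕ} (k : ℕ) (p : ℝ≥0∞) (Ω : Set (EucSpace n)) (v : EucSpace n → ℝ) : Prop :=
  MemLp v p (volume.restrict Ω) ∧
    ∀ m : ℕ, m ≤ k → ∀ α : Fin m → Fin n,
      ∃ g : EucSpace n → ℝ, HasWeakDeriv Ω α v g ∧ MemLp g p (volume.restrict Ω)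

open Classical in
/-- The weak derivative (unique almost everywhere on an open `Ω`) if it exists, and `0` if not. -/
noncomputable def weakDeriv {n m : ℕ} (Ω : Set (EucSpace n)) (α : Fin m → Fin n)
    (v : EucSpace n → ℝ) : EucSpace n → ℝ :=
  if h : ∃ g : EucSpace n → ℝ, HasWeakDeriv Ω α v g then h.choose else 0

open Classical in
/-- The Sobolev seminorm `|v|_{k,p,Ω}`. The sum runs over the `n ^ k` ordered derivatives
`∂_{α 0} ⋯ ∂_{α (k-1)}` of order `k`, i.e. over the entries of `∇ ⊗ ⋯ ⊗ ∇ v`: a multi-index `δ`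
with `|δ| = k` is counted `k! / δ!` times. -/
noncomputable def sobolevSeminorm {n : ℕ} (k : ℕ) (p : ℝ≥0∞) (Ω : Set (EucSpace n))
    (v : EucSpace n → ℝ) : ℝ :=
  if p = ⊤ then
    ⨆ α : Fin k → Fin n, (eLpNorm (weakDeriv Ω α v) ⊤ (volume.restrict Ω)).toReal
  else
    (∑ α : Fin k → Fin n,
      (eLpNorm (weakDeriv Ω α v) p (volume.restrict Ω)).toReal ^ p.toReal) ^ (1 / p.toReal)

/-- The affine map `x ↦ A x + b`. -/
noncomputable def affineTransform {n : ℕ} (A : Matrix (Fin n) (Fin n) ℝ) (b : EucSpace n) :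
    EucSpace n → EucSpace n :=
  fun x => Matrix.toEuclideanCLM (𝕜 := ℝ) A x + b

/-- The matrix norm associated with the Euclidean norm. -/
noncomputable def euclideanMatrixNorm {n : ℕ} (A : Matrix (Fin n) (Fin n) ℝ) : ℝ :=
  ‖Matrix.toEuclideanCLM (𝕜 := ℝ) A‖

open Classical in
/-- `τ(p)`, for `1 ≤ p < ∞`. -/
noncomputable def tauExp (p : ℝ) : ℝ := if p ≤ 2 then 1 - p / 2 else 0

open Classical in
/-- `γ(p)`, for `1 ≤ p < ∞`. -/
noncomputable def gammaExp (p : ℝ) : ℝ := if p ≤ 2 then 0 else p / 2 - 1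

open Classical in
/-- `μ(p)`, for `1 ≤ p ≤ ∞`, with `1 / ∞ = 0`. -/
noncomputable def muExp (p : ℝ≥0∞) : ℝ :=
  if p ≤ 2 then (p⁻¹).toReal - 1 / 2 else 1 / 2 - (p⁻¹).toReal

open WithLp
open scoped Matrix Matrix.Norms.L2Operator

/-!
By the chain rule, which passes to weak derivatives by testing against `F ∘ φ`, the `k`-th gradient
of `v ∘ φ` is `(A ⊗ ⋯ ⊗ A)ᵀ` applied to the `k`-th gradient of `v`. Peeling off one tensor factor at
a time shows that the `k`-fold Kronecker power has `ℓ²` operator norm at most `‖A‖ ^ k`. Passing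
between the `ℓ²` and `ℓᵖ` norms on `n ^ k` coordinates costs a factor `(n ^ k) ^ μ(p)`, only one of
the two comparisons (before or after applying the matrix) being lossy. The seminorm is the `Lᵖ` norm
of the pointwise `ℓᵖ` norm of the gradient, so the substitution `y = φ x` contributes
`|det A| ^ (1 / p)`. This gives the lower bound, and the lower bound for `φ⁻¹` is the upper bound.
-/

section LpComparison

variable {ι : Type*} [Fintype ι] {p q : ℝ≥0∞}

theorem norm_toLp_rpow_toReal {E : ι → Type*} [∀ i, SeminormedAddCommGroup (E i)]
    (hp : 0 < p.toReal) (x : ∀ i, E i) : ‖toLp p x‖ ^ p.toReal = ∑ i, ‖x i‖ ^ p.toReal := by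
  rw [PiLp.norm_eq_sum hp, one_div, Real.rpow_inv_rpow (by positivity) hp.ne']

variable [hp : Fact (1 ≤ p)] [hq : Fact (1 ≤ q)]

theorem norm_toLp_anti {E : ι → Type*} [∀ i, SeminormedAddCommGroup (E i)] (hpq : p ≤ q)
    (x : ∀ i, E i) : ‖toLp q x‖ ≤ ‖toLp p x‖ := by
  rcases q.dichotomy with rfl | hq1
  · rw [PiLp.norm_eq_ciSup]
    exact Real.iSup_le (PiLp.norm_apply_le (toLp p x)) (norm_nonneg _)
  have hq_top : q ≠ ⊤ := fun h => by norm_num [h] at hq1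
  have hp0 : 0 < p.toReal :=
    ENNReal.toReal_pos (zero_lt_one.trans_le hp.out).ne' (ne_top_of_le_ne_top hq_top hpq)
  have hq0 : 0 < q.toReal := zero_lt_one.trans_le hq1
  have hpq' : p.toReal ≤ q.toReal := ENNReal.toReal_mono hq_top hpq
  rw [← Real.rpow_le_rpow_iff (norm_nonneg _) (norm_nonneg _) hq0]
  calc ‖toLp q x‖ ^ q.toReal
      = ∑ i, ‖x i‖ ^ p.toReal * ‖x i‖ ^ (q.toReal - p.toReal) := by
        rw [norm_toLp_rpow_toReal hq0]
        refine Finset.sum_congr rfl fun i _ => ?_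
        rw [← Real.rpow_add_of_nonneg (norm_nonneg _) hp0.le (sub_nonneg.2 hpq'),
          add_sub_cancel]
    _ ≤ ∑ i, ‖x i‖ ^ p.toReal * ‖toLp p x‖ ^ (q.toReal - p.toReal) := by
        gcongr with i
        exact PiLp.norm_apply_le (toLp p x) i
    _ = ‖toLp p x‖ ^ q.toReal := by
        rw [← Finset.sum_mul, ← norm_toLp_rpow_toReal hp0,
          ← Real.rpow_add_of_nonneg (norm_nonneg _) hp0.le (sub_nonneg.2 hpq'), add_sub_cancel]

theorem enorm_toLp_eq_eLpNorm_count {E : Type*} [SeminormedAddCommGroup E] [MeasurableSpace ι]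
    [MeasurableSingletonClass ι] (x : ι → E) : ‖toLp p x‖ₑ = eLpNorm x p Measure.count := by
  rcases p.dichotomy with rfl | hp1
  · simp only [eLpNorm_exponent_top, eLpNormEssSup_count]
    rw [enorm_eq_nnnorm, PiLp.nnnorm_eq_ciSup, ENNReal.coe_iSup (Set.finite_range _).bddAbove]
    rfl
  · have hp0 : 0 < p.toReal := zero_lt_one.trans_le hp1
    have hp_top : p ≠ ⊤ := fun h => by norm_num [h] at hp1
    rw [eLpNorm_eq_lintegral_rpow_enorm_toReal (zero_lt_one.trans_le hp.out).ne' hp_top,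
      lintegral_count, tsum_fintype, ← ofReal_norm, PiLp.norm_eq_sum hp0,
      ← ENNReal.ofReal_rpow_of_nonneg (by positivity) (by positivity),
      ENNReal.ofReal_sum_of_nonneg fun i _ => by positivity]
    simp only [← ENNReal.ofReal_rpow_of_nonneg (norm_nonneg _) hp0.le, ofReal_norm]

theorem norm_toLp_le_card_rpow_mul_norm_toLp {E : Type*} [SeminormedAddCommGroup E] (hpq : p ≤ q)
    (x : ι → E) :
    ‖toLp p x‖ ≤ (Fintype.card ι : ℝ) ^ (p⁻¹.toReal - q⁻¹.toReal) * ‖toLp q x‖ := by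
  let _ : MeasurableSpace ι := ⊤
  have hexp : 0 ≤ p⁻¹.toReal - q⁻¹.toReal := sub_nonneg.2 <|
    ENNReal.toReal_mono (ENNReal.inv_ne_top.2 (zero_lt_one.trans_le hp.out).ne')
      (ENNReal.inv_le_inv.2 hpq)
  have h := eLpNorm_le_eLpNorm_mul_rpow_measure_univ (μ := Measure.count) hpq
    (f := x) StronglyMeasurable.of_discrete.aestronglyMeasurable
  rw [← enorm_toLp_eq_eLpNorm_count, ← enorm_toLp_eq_eLpNorm_count] at h
  simp only [one_div, ← ENNReal.toReal_inv, Measure.count_univ, ENat.card_eq_coe_fintype_card,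
    ENat.toENNReal_coe] at h
  have hfin : ‖toLp q x‖ₑ * (Fintype.card ι : ℝ≥0∞) ^ (p⁻¹.toReal - q⁻¹.toReal) ≠ ⊤ :=
    ENNReal.mul_ne_top enorm_ne_top
      (ENNReal.rpow_ne_top_of_nonneg hexp (ENNReal.natCast_ne_top _))
  simpa only [ENNReal.toReal_mul, toReal_enorm, ← ENNReal.toReal_rpow, ENNReal.toReal_natCast,
    mul_comm] using ENNReal.toReal_mono hfin h

end LpComparison

section KroneckerPow

/-- The Kronecker power `A ⊗ ⋯ ⊗ A` with `m` factors, with rows and columns indexed by `m`-tuples: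
its transpose is the coordinate expression of the pull-back by `A` of covariant tensors of
order `m`. -/
def kroneckerPow {ι κ R : Type*} [CommMonoid R] (A : Matrix ι κ R) (m : ℕ) :
    Matrix (Fin m → ι) (Fin m → κ) R :=
  Matrix.of fun α β => ∏ i, A (α i) (β i)

theorem sum_fin_succ_fun {ι M : Type*} [Fintype ι] [AddCommMonoid M] {m : ℕ}
    (f : (Fin (m + 1) → ι) → M) : ∑ α, f α = ∑ i, ∑ α : Fin m → ι, f (Fin.cons i α) := by
  rw [← Fintype.sum_prod_type']
  exact (Fintype.sum_equiv (Fin.consEquiv fun _ => ι) _ _ fun _ => rfl).symm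

theorem kroneckerPow_succ_mulVec_cons {ι κ R : Type*} [Fintype κ] [CommSemiring R]
    (A : Matrix ι κ R) (m : ℕ) (x : (Fin (m + 1) → κ) → R) (i : ι) (α : Fin m → ι) :
    (kroneckerPow A (m + 1) *ᵥ x) (Fin.cons i α) =
      (A *ᵥ fun j => (kroneckerPow A m *ᵥ fun β => x (Fin.cons j β)) α) i := by
  simp only [Matrix.mulVec, dotProduct, kroneckerPow, Matrix.of_apply, sum_fin_succ_fun,
    Fin.prod_univ_succ, Fin.cons_zero, Fin.cons_succ, Finset.mul_sum, mul_assoc]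

variable {𝕜 ι κ : Type*} [RCLike 𝕜] [Fintype ι] [Fintype κ] [DecidableEq κ]

theorem sum_norm_sq_mulVec_le (A : Matrix ι κ 𝕜) (x : κ → 𝕜) :
    ∑ i, ‖(A *ᵥ x) i‖ ^ 2 ≤ ‖A‖ ^ 2 * ∑ j, ‖x j‖ ^ 2 := by
  have h := pow_le_pow_left₀ (norm_nonneg _) (A.l2_opNorm_mulVec (toLp 2 x)) 2
  rwa [mul_pow, EuclideanSpace.norm_sq_eq, EuclideanSpace.norm_sq_eq] at h

theorem sum_norm_sq_kroneckerPow_mulVec_le (A : Matrix ι κ 𝕜) (m : ℕ) (x : (Fin m → κ) → 𝕜) :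
    ∑ α, ‖(kroneckerPow A m *ᵥ x) α‖ ^ 2 ≤ (‖A‖ ^ m) ^ 2 * ∑ β, ‖x β‖ ^ 2 := by
  induction m with
  | zero => simp [kroneckerPow, Matrix.mulVec, dotProduct]
  | succ m ih =>
    simp only [sum_fin_succ_fun, kroneckerPow_succ_mulVec_cons]
    rw [Finset.sum_comm]
    calc _ ≤ ∑ α : Fin m → ι, ‖A‖ ^ 2 *
          ∑ j, ‖(kroneckerPow A m *ᵥ fun β => x (Fin.cons j β)) α‖ ^ 2 :=
          Finset.sum_le_sum fun α _ => sum_norm_sq_mulVec_le A _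
      _ = ‖A‖ ^ 2 * ∑ j, ∑ α, ‖(kroneckerPow A m *ᵥ fun β => x (Fin.cons j β)) α‖ ^ 2 := by
          rw [← Finset.mul_sum, Finset.sum_comm]
      _ ≤ ‖A‖ ^ 2 * ∑ j, (‖A‖ ^ m) ^ 2 * ∑ β, ‖x (Fin.cons j β)‖ ^ 2 := by
          gcongr with j
          exact ih _
      _ = (‖A‖ ^ (m + 1)) ^ 2 * ∑ j, ∑ β, ‖x (Fin.cons j β)‖ ^ 2 := by
          rw [← Finset.mul_sum]
          ring

theorem l2_opNorm_kroneckerPow_le (A : Matrix ι κ 𝕜) (m : ℕ) : ‖kroneckerPow A m‖ ≤ ‖A‖ ^ m := by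
  rw [Matrix.l2_opNorm_def]
  refine ContinuousLinearMap.opNorm_le_bound _ (by positivity) fun x => ?_
  refine le_of_sq_le_sq ?_ (by positivity)
  rw [mul_pow, EuclideanSpace.norm_sq_eq, EuclideanSpace.norm_sq_eq]
  exact sum_norm_sq_kroneckerPow_mulVec_le A m x

theorem norm_toLp_mulVec_le {p : ℝ≥0∞} [Fact (1 ≤ p)] (M : Matrix κ κ 𝕜) (x : κ → 𝕜) :
    ‖toLp p (M *ᵥ x)‖ ≤ (Fintype.card κ : ℝ) ^ muExp p * ‖M‖ * ‖toLp p x‖ := by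
  have h2 : ‖toLp 2 (M *ᵥ x)‖ ≤ ‖M‖ * ‖toLp 2 x‖ := M.l2_opNorm_mulVec (toLp 2 x)
  have two_inv : (2 : ℝ≥0∞)⁻¹.toReal = 1 / 2 := by norm_num
  rw [muExp, ← two_inv]
  split_ifs with hp2
  · calc ‖toLp p (M *ᵥ x)‖
        ≤ (Fintype.card κ : ℝ) ^ (p⁻¹.toReal - (2 : ℝ≥0∞)⁻¹.toReal) * ‖toLp 2 (M *ᵥ x)‖ :=
          norm_toLp_le_card_rpow_mul_norm_toLp hp2 _
      _ ≤ (Fintype.card κ : ℝ) ^ (p⁻¹.toReal - (2 : ℝ≥0∞)⁻¹.toReal) *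
            (‖M‖ * ‖toLp p x‖) := by
          gcongr
          exact h2.trans (by gcongr; exact norm_toLp_anti hp2 x)
      _ = _ := by ring
  · have h2p : 2 ≤ p := (not_le.1 hp2).le
    calc ‖toLp p (M *ᵥ x)‖ ≤ ‖toLp 2 (M *ᵥ x)‖ := norm_toLp_anti h2p _
      _ ≤ ‖M‖ * ‖toLp 2 x‖ := h2
      _ ≤ ‖M‖ * ((Fintype.card κ : ℝ) ^ ((2 : ℝ≥0∞)⁻¹.toReal - p⁻¹.toReal) * ‖toLp p x‖) := by
          gcongr
          exact norm_toLp_le_card_rpow_mul_norm_toLp h2p x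
      _ = _ := by ring

end KroneckerPow

section LpOfPiLp

variable {X ι E : Type*} [MeasurableSpace X] [Fintype ι] [NormedAddCommGroup E] {p : ℝ≥0∞}
  {μ : Measure X} {f : ι → X → E}

theorem toReal_eLpNorm_toLp_top (hf : ∀ i, MemLp (f i) ⊤ μ) :
    (eLpNorm (fun x => toLp ⊤ fun i => f i x) ⊤ μ).toReal =
      ‖toLp ⊤ fun i => (eLpNorm (f i) ⊤ μ).toReal‖ := by
  rw [PiLp.norm_eq_ciSup]
  simp only [Real.norm_of_nonneg ENNReal.toReal_nonneg]
  refine le_antisymm ?_ (Real.iSup_le (fun i => ?_) ENNReal.toReal_nonneg)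
  · refine ENNReal.toReal_le_of_le_ofReal (Real.iSup_nonneg fun _ => ENNReal.toReal_nonneg) ?_
    rw [eLpNorm_exponent_top]
    refine eLpNormEssSup_le_of_ae_bound ?_
    filter_upwards [ae_all_iff.2 fun i => enorm_ae_le_eLpNormEssSup (f i) μ] with x hx
    rw [PiLp.norm_eq_ciSup]
    refine Real.iSup_le (fun i => ?_) (Real.iSup_nonneg fun _ => ENNReal.toReal_nonneg)
    refine le_ciSup_of_le (Set.finite_range _).bddAbove i ?_
    simpa only [toReal_enorm] using ENNReal.toReal_mono (hf i).eLpNorm_ne_top (hx i)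
  · exact ENNReal.toReal_mono (MemLp.of_eval_piLp hf).eLpNorm_ne_top
      (eLpNorm_mono fun x => PiLp.norm_apply_le (toLp ⊤ fun i => f i x) i)

theorem toReal_eLpNorm_rpow_toReal {g : X → E} (hp0 : p ≠ 0) (hp_top : p ≠ ⊤)
    (hg : MemLp g p μ) :
    (eLpNorm g p μ).toReal ^ p.toReal = ∫ x, ‖g x‖ ^ p.toReal ∂μ := by
  rw [hg.eLpNorm_eq_integral_rpow_norm hp0 hp_top, ENNReal.toReal_ofReal (by positivity),
    Real.rpow_inv_rpow (by positivity) (ENNReal.toReal_pos hp0 hp_top).ne']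

theorem toReal_eLpNorm_toLp [Fact (1 ≤ p)] (hf : ∀ i, MemLp (f i) p μ) :
    (eLpNorm (fun x => toLp p fun i => f i x) p μ).toReal =
      ‖toLp p fun i => (eLpNorm (f i) p μ).toReal‖ := by
  rcases eq_or_ne p ⊤ with rfl | hp_top
  · exact toReal_eLpNorm_toLp_top hf
  have hp0 : p ≠ 0 := (zero_lt_one.trans_le (Fact.out : 1 ≤ p)).ne'
  have hp_pos : 0 < p.toReal := ENNReal.toReal_pos hp0 hp_top
  rw [← Real.rpow_left_inj ENNReal.toReal_nonneg (norm_nonneg _) hp_pos.ne',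
    toReal_eLpNorm_rpow_toReal hp0 hp_top (MemLp.of_eval_piLp hf)]
  simp only [norm_toLp_rpow_toReal hp_pos, Real.norm_of_nonneg ENNReal.toReal_nonneg,
    toReal_eLpNorm_rpow_toReal hp0 hp_top (hf _)]
  exact integral_finsetSum _ fun i _ => (hf i).integrable_norm_rpow hp0 hp_top

end LpOfPiLp

section AffineTransform

variable {n : ℕ}

theorem contDiff_affineTransform (A : Matrix (Fin n) (Fin n) ℝ) (b : EucSpace n)
    {r : WithTop ℕ∞} : ContDiff ℝ r (affineTransform A b) :=
  (ContinuousLinearMap.contDiff _).add contDiff_const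

theorem toEuclideanCLM_single (A : Matrix (Fin n) (Fin n) ℝ) (j : Fin n) :
    Matrix.toEuclideanCLM (𝕜 := ℝ) A (EuclideanSpace.single j 1) =
      ∑ i, A i j • EuclideanSpace.single i (1 : ℝ) := by
  ext l
  simp [Matrix.ofLp_toEuclideanCLM, Pi.single_apply]

theorem partialDeriv_comp_affineTransform {m : ℕ} (A : Matrix (Fin n) (Fin n) ℝ)
    (b : EucSpace n) {F : EucSpace n → ℝ} (hF : ContDiff ℝ m F) (β : Fin m → Fin n)
    (x : EucSpace n) :
    partialDeriv β (F ∘ affineTransform A b) x =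
      ((kroneckerPow A m)ᵀ *ᵥ fun α => partialDeriv α F (affineTransform A b x)) β := by
  have iteratedFDeriv_comp : iteratedFDeriv ℝ m (F ∘ affineTransform A b) x =
      (iteratedFDeriv ℝ m F (affineTransform A b x)).compContinuousLinearMap
        fun _ => Matrix.toEuclideanCLM (𝕜 := ℝ) A := by
    have comp_eq : F ∘ affineTransform A b =
        (fun y => F (y + b)) ∘ Matrix.toEuclideanCLM (𝕜 := ℝ) A := rfl
    have contDiff_translate : ContDiff ℝ m fun y => F (y + b) :=
      hF.comp (contDiff_id.add contDiff_const)
    rw [comp_eq, ContinuousLinearMap.iteratedFDeriv_comp_right _ contDiff_translate x le_rfl,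
      iteratedFDeriv_comp_add_right]
    rfl
  simp only [partialDeriv, iteratedFDeriv_comp,
    ContinuousMultilinearMap.compContinuousLinearMap_apply, toEuclideanCLM_single,
    ContinuousMultilinearMap.map_sum, ContinuousMultilinearMap.map_smul_univ, Matrix.mulVec,
    dotProduct, Matrix.transpose_apply, kroneckerPow, Matrix.of_apply, smul_eq_mul]

variable {A : Matrix (Fin n) (Fin n) ℝ}

theorem toEuclideanCLM_inv_apply (hA : A.det ≠ 0) (x : EucSpace n) :
    Matrix.toEuclideanCLM (𝕜 := ℝ) A⁻¹ (Matrix.toEuclideanCLM (𝕜 := ℝ) A x) = x := by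
  rw [← mul_apply_eq_comp, ← map_mul, Matrix.nonsing_inv_mul A hA.isUnit, map_one,
    one_apply_eq_self]

theorem toEuclideanCLM_apply_inv (hA : A.det ≠ 0) (x : EucSpace n) :
    Matrix.toEuclideanCLM (𝕜 := ℝ) A (Matrix.toEuclideanCLM (𝕜 := ℝ) A⁻¹ x) = x := by
  rw [← mul_apply_eq_comp, ← map_mul, Matrix.mul_nonsing_inv A hA.isUnit, map_one,
    one_apply_eq_self]

/-- The affine transformation `x ↦ A x + b` with regular `A` as a homeomorphism. Its inverse
`y ↦ A⁻¹ y - A⁻¹ b` is again written as an `affineTransform`, so that every statement about `A`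
and `b` also applies to the inverse. -/
noncomputable def affineTransformHomeomorph (A : Matrix (Fin n) (Fin n) ℝ) (hA : A.det ≠ 0)
    (b : EucSpace n) : EucSpace n ≃ₜ EucSpace n where
  toFun := affineTransform A b
  invFun := affineTransform A⁻¹ (-Matrix.toEuclideanCLM (𝕜 := ℝ) A⁻¹ b)
  left_inv x := by simp [affineTransform, toEuclideanCLM_inv_apply hA]
  right_inv x := by simp [affineTransform, toEuclideanCLM_apply_inv hA]
  continuous_toFun := (contDiff_affineTransform A b (r := 0)).continuous
  continuous_invFun := (contDiff_affineTransform _ _ (r := 0)).continuous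

theorem measurableEmbedding_affineTransform (hA : A.det ≠ 0) (b : EucSpace n) :
    MeasurableEmbedding (affineTransform A b) :=
  (affineTransformHomeomorph A hA b).measurableEmbedding

theorem map_volume_affineTransform (hA : A.det ≠ 0) (b : EucSpace n) :
    (volume : Measure (EucSpace n)).map (affineTransform A b) =
      ENNReal.ofReal |A.det|⁻¹ • volume := by
  set L : EucSpace n →L[ℝ] EucSpace n := Matrix.toEuclideanCLM (𝕜 := ℝ) A with hL
  have det_L : LinearMap.det (L : EucSpace n →ₗ[ℝ] EucSpace n) = A.det := by
    rw [hL, Matrix.coe_toEuclideanCLM_eq_toEuclideanLin, Matrix.toEuclideanLin,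
      Matrix.toLpLin_eq_toLin, LinearMap.det_toLin]
  have map_L : (volume : Measure (EucSpace n)).map L = ENNReal.ofReal |A.det|⁻¹ • volume := by
    rw [← abs_inv, ← det_L]
    exact Measure.map_linearMap_addHaar_eq_smul_addHaar volume (by rwa [det_L])
  have comp_eq : affineTransform A b = (· + b) ∘ L := rfl
  rw [comp_eq, ← Measure.map_map (measurable_add_const b) L.measurable, map_L, Measure.map_smul,
    map_add_right_eq_self]

theorem map_restrict_preimage_affineTransform (hA : A.det ≠ 0) (b : EucSpace n)
    (Ω : Set (EucSpace n)) :
    (volume.restrict (affineTransform A b ⁻¹' Ω)).map (affineTransform A b) =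
      ENNReal.ofReal |A.det|⁻¹ • volume.restrict Ω := by
  rw [← (measurableEmbedding_affineTransform hA b).restrict_map,
    map_volume_affineTransform hA, Measure.restrict_smul]

theorem setIntegral_comp_affineTransform {F : Type*} [NormedAddCommGroup F] [NormedSpace ℝ F]
    (hA : A.det ≠ 0) (b : EucSpace n) (Ω : Set (EucSpace n)) (f : EucSpace n → F) :
    ∫ x in affineTransform A b ⁻¹' Ω, f (affineTransform A b x) =
      |A.det|⁻¹ • ∫ y in Ω, f y := by
  rw [← (measurableEmbedding_affineTransform hA b).integral_map,
    map_restrict_preimage_affineTransform hA, integral_smul_measure,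
    ENNReal.toReal_ofReal (by positivity)]

variable {F : Type*} [NormedAddCommGroup F] {p : ℝ≥0∞} {Ω : Set (EucSpace n)}
  {f : EucSpace n → F}

theorem eLpNorm_comp_affineTransform (hA : A.det ≠ 0) (b : EucSpace n) (f : EucSpace n → F) :
    eLpNorm (f ∘ affineTransform A b) p (volume.restrict (affineTransform A b ⁻¹' Ω)) =
      ENNReal.ofReal |A.det|⁻¹ ^ p⁻¹.toReal * eLpNorm f p (volume.restrict Ω) := by
  have hdet : ENNReal.ofReal |A.det|⁻¹ ≠ 0 :=
    (ENNReal.ofReal_pos.2 (inv_pos.2 (abs_pos.2 hA))).ne'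
  rw [← (measurableEmbedding_affineTransform hA b).eLpNorm_map_measure,
    map_restrict_preimage_affineTransform hA, eLpNorm_smul_measure_of_ne_zero hdet, one_div,
    smul_eq_mul]

theorem memLp_comp_affineTransform (hA : A.det ≠ 0) (b : EucSpace n)
    (hf : MemLp f p (volume.restrict Ω)) :
    MemLp (f ∘ affineTransform A b) p (volume.restrict (affineTransform A b ⁻¹' Ω)) := by
  refine MemLp.comp_of_map ?_ (measurableEmbedding_affineTransform hA b).measurable.aemeasurable
  rw [map_restrict_preimage_affineTransform hA]
  exact hf.smul_measure ENNReal.ofReal_ne_top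

theorem locallyIntegrableOn_comp_affineTransform (hA : A.det ≠ 0) (b : EucSpace n)
    (hΩ : IsOpen Ω) (hf : LocallyIntegrableOn f Ω) :
    LocallyIntegrableOn (f ∘ affineTransform A b) (affineTransform A b ⁻¹' Ω) := by
  set φ := affineTransformHomeomorph A hA b
  refine (locallyIntegrableOn_iff (hΩ.preimage φ.continuous).isLocallyClosed).2 ?_
  intro K hKΩ hK
  have integrableOn_image : IntegrableOn f (φ '' K) :=
    hf.integrableOn_compact_subset (Set.image_subset_iff.2 hKΩ) (hK.image φ.continuous)
  rw [IntegrableOn, ← memLp_one_iff_integrable] at integrableOn_image ⊢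
  have preimage_image : affineTransform A b ⁻¹' (φ '' K) = K := φ.preimage_image K
  exact preimage_image ▸ memLp_comp_affineTransform hA b integrableOn_image

end AffineTransform

section WeakDerivative

variable {n m : ℕ} {Ω : Set (EucSpace n)} {v f : EucSpace n → ℝ}

theorem continuous_partialDeriv (hf : ContDiff ℝ m f) (α : Fin m → Fin n) :
    Continuous (partialDeriv α f) :=
  (ContinuousMultilinearMap.apply ℝ (fun _ : Fin m => EucSpace n) ℝ
    fun i => EuclideanSpace.single (α i) (1 : ℝ)).continuous.comp
    (hf.continuous_iteratedFDeriv le_rfl)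

theorem tsupport_partialDeriv_subset (f : EucSpace n → ℝ) (α : Fin m → Fin n) :
    tsupport (partialDeriv α f) ⊆ tsupport f := by
  refine closure_minimal (fun x hx => ?_) (isClosed_tsupport f)
  refine support_iteratedFDeriv_subset (𝕜 := ℝ) m (Function.mem_support.2 fun h => hx ?_)
  rw [partialDeriv, h, zero_apply]

theorem integrableOn_mul_of_tsupport_subset (hv : LocallyIntegrableOn v Ω) (hf : Continuous f)
    (hf_compact : HasCompactSupport f) (hfΩ : tsupport f ⊆ Ω) :
    IntegrableOn (fun x => v x * f x) Ω := by
  have integrableOn_tsupport : IntegrableOn (fun x => v x * f x) (tsupport f) :=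
    (hv.integrableOn_compact_subset hfΩ hf_compact).mul_continuousOn hf.continuousOn hf_compact
  exact ((integrableOn_iff_integrable_of_support_subset
    ((Function.support_mul_subset_right v f).trans (subset_tsupport f))).1
    integrableOn_tsupport).integrableOn

theorem IsTestFunction.integrableOn_mul (hf : IsTestFunction Ω f)
    (hv : LocallyIntegrableOn v Ω) : IntegrableOn (fun x => v x * f x) Ω :=
  integrableOn_mul_of_tsupport_subset hv hf.1.continuous hf.2.1 hf.2.2

theorem IsTestFunction.integrableOn_mul_partialDeriv (hf : IsTestFunction Ω f)
    (hv : LocallyIntegrableOn v Ω) (α : Fin m → Fin n) :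
    IntegrableOn (fun x => v x * partialDeriv α f x) Ω :=
  integrableOn_mul_of_tsupport_subset hv
    (continuous_partialDeriv (hf.1.of_le (mod_cast le_top)) α)
    (hf.2.1.mono' (subset_closure.trans (tsupport_partialDeriv_subset f α)))
    ((tsupport_partialDeriv_subset f α).trans hf.2.2)

variable {A : Matrix (Fin n) (Fin n) ℝ}

theorem IsTestFunction.exists_eq_comp_affineTransform (hA : A.det ≠ 0) (b : EucSpace n)
    (hf : IsTestFunction (affineTransform A b ⁻¹' Ω) f) :
    ∃ F, IsTestFunction Ω F ∧ f = F ∘ affineTransform A b := by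
  set φ := affineTransformHomeomorph A hA b
  refine ⟨f ∘ φ.symm, ⟨hf.1.comp (contDiff_affineTransform _ _), hf.2.1.comp_homeomorph _, ?_⟩, ?_⟩
  · rw [tsupport_comp_eq_preimage]
    intro y hy
    exact φ.apply_symm_apply y ▸ hf.2.2 hy
  · funext x
    exact congrArg f (φ.symm_apply_apply x).symm

theorem memLp_mulVec_apply {X ι κ 𝕜 : Type*} [MeasurableSpace X] [Fintype κ] [RCLike 𝕜]
    {μ : Measure X} {p : ℝ≥0∞} (M : Matrix ι κ 𝕜) {H : X → κ → 𝕜}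
    (hH : ∀ j, MemLp (fun x => H x j) p μ) (i : ι) : MemLp (fun x => (M *ᵥ H x) i) p μ :=
  memLp_finsetSum _ fun j _ => (hH j).const_mul _

theorem integral_mulVec_apply {X ι κ 𝕜 : Type*} [MeasurableSpace X] [Fintype κ] [RCLike 𝕜]
    {μ : Measure X} (M : Matrix ι κ 𝕜) {H : X → κ → 𝕜}
    (hH : ∀ j, Integrable (fun x => H x j) μ) (i : ι) :
    ∫ x, (M *ᵥ H x) i ∂μ = (M *ᵥ fun j => ∫ x, H x j ∂μ) i := by
  simp only [Matrix.mulVec, dotProduct]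
  rw [integral_finsetSum _ fun j _ => (hH j).const_mul _]
  simp only [integral_const_mul]

theorem setIntegral_mulVec_comp_affineTransform {ι κ : Type*} [Fintype κ] (hA : A.det ≠ 0)
    (b : EucSpace n) (M : Matrix ι κ ℝ) {H : EucSpace n → κ → ℝ}
    (hH : ∀ j, IntegrableOn (fun y => H y j) Ω) (i : ι) :
    ∫ x in affineTransform A b ⁻¹' Ω, (M *ᵥ H (affineTransform A b x)) i =
      |A.det|⁻¹ * (M *ᵥ fun j => ∫ y in Ω, H y j) i := by
  rw [← integral_mulVec_apply M hH]
  exact setIntegral_comp_affineTransform hA b Ω fun y => (M *ᵥ H y) i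

theorem HasWeakDeriv.comp_affineTransform (hA : A.det ≠ 0) (b : EucSpace n) (hΩ : IsOpen Ω)
    {G : EucSpace n → (Fin m → Fin n) → ℝ} (hG : ∀ α, HasWeakDeriv Ω α v fun y => G y α)
    (β : Fin m → Fin n) :
    HasWeakDeriv (affineTransform A b ⁻¹' Ω) β (v ∘ affineTransform A b)
      fun x => ((kroneckerPow A m)ᵀ *ᵥ G (affineTransform A b x)) β := by
  set K := (kroneckerPow A m)ᵀ with hK
  have mulVec_const_mul (c : ℝ) (x : (Fin m → Fin n) → ℝ) :
      (K *ᵥ fun α => c * x α) β = c * (K *ᵥ x) β := congrFun (K.mulVec_smul c x) β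
  refine ⟨locallyIntegrableOn_comp_affineTransform hA b hΩ (hG β).1, ?_, fun f hf => ?_⟩
  · refine locallyIntegrableOn_comp_affineTransform hA b hΩ (f := fun y => (K *ᵥ G y) β) ?_
    rw [locallyIntegrableOn_iff hΩ.isLocallyClosed]
    exact fun C hCΩ hC => memLp_one_iff_integrable.1 <| memLp_mulVec_apply K
      (fun α => memLp_one_iff_integrable.2 ((hG α).2.1.integrableOn_compact_subset hCΩ hC)) β
  · obtain ⟨F, hF, rfl⟩ := hf.exists_eq_comp_affineTransform hA b
    set φ := affineTransform A b
    calc ∫ x in φ ⁻¹' Ω, (v ∘ φ) x * partialDeriv β (F ∘ φ) x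
        = ∫ x in φ ⁻¹' Ω, (K *ᵥ fun α => v (φ x) * partialDeriv α F (φ x)) β := by
          simp only [partialDeriv_comp_affineTransform A b (hF.1.of_le (mod_cast le_top)), φ, ← hK,
            mulVec_const_mul, Function.comp_apply]
      _ = |A.det|⁻¹ * (K *ᵥ fun α => ∫ y in Ω, v y * partialDeriv α F y) β :=
          setIntegral_mulVec_comp_affineTransform hA b K
            (fun α => hF.integrableOn_mul_partialDeriv (hG α).1 α) β
      _ = (-1) ^ m * (|A.det|⁻¹ * (K *ᵥ fun α => ∫ y in Ω, F y * G y α) β) := by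
          simp only [(hG _).2.2 F hF, mulVec_const_mul, mul_comm (F _)]
          ring
      _ = (-1) ^ m * ∫ x in φ ⁻¹' Ω, (K *ᵥ fun α => F (φ x) * G (φ x) α) β := by
          rw [← setIntegral_mulVec_comp_affineTransform hA b K (H := fun y α => F y * G y α)
            fun α => by simpa only [mul_comm] using hF.integrableOn_mul (hG α).2.1]
      _ = (-1) ^ m * ∫ x in φ ⁻¹' Ω, (K *ᵥ G (φ x)) β * (F ∘ φ) x := by
          simp only [mulVec_const_mul, Function.comp_apply]
          simp only [mul_comm]

end WeakDerivative

section Sobolev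

variable {n k m : ℕ} {p : ℝ≥0∞} {Ω : Set (EucSpace n)} {v g h : EucSpace n → ℝ}

theorem HasWeakDeriv.ae_eq (hΩ : IsOpen Ω) {α : Fin m → Fin n} (hg : HasWeakDeriv Ω α v g)
    (hh : HasWeakDeriv Ω α v h) : g =ᵐ[volume.restrict Ω] h := by
  have integral_mul_eq {f : EucSpace n → ℝ} (hf : IsTestFunction Ω f) :
      ∫ x in Ω, g x * f x = ∫ x in Ω, h x * f x :=
    mul_left_cancel₀ (pow_ne_zero m (by norm_num)) ((hg.2.2 f hf).symm.trans (hh.2.2 f hf))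
  have sub_ae_eq_zero : ∀ᵐ x, x ∈ Ω → (g - h) x = 0 := by
    refine hΩ.ae_eq_zero_of_integral_contDiff_smul_eq_zero (hg.2.1.sub hh.2.1)
      fun f f_smooth f_compact hfΩ => ?_
    have hf : IsTestFunction Ω f := ⟨f_smooth, f_compact, hfΩ⟩
    rw [← setIntegral_eq_integral_of_forall_compl_eq_zero (s := Ω) fun x hx => by
      rw [image_eq_zero_of_notMem_tsupport fun hx' => hx (hfΩ hx'), zero_smul]]
    simp only [Pi.sub_apply, smul_eq_mul, mul_comm (f _), sub_mul]
    rw [integral_sub (hf.integrableOn_mul hg.2.1) (hf.integrableOn_mul hh.2.1),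
      integral_mul_eq hf, sub_self]
  rw [Filter.EventuallyEq, ae_restrict_iff' hΩ.measurableSet]
  filter_upwards [sub_ae_eq_zero] with x hx hxΩ using sub_eq_zero.1 (hx hxΩ)

theorem HasWeakDeriv.hasWeakDeriv_weakDeriv {α : Fin m → Fin n} (hg : HasWeakDeriv Ω α v g) :
    HasWeakDeriv Ω α v (weakDeriv Ω α v) := by
  have exists_weakDeriv : ∃ g, HasWeakDeriv Ω α v g := ⟨g, hg⟩
  rw [weakDeriv, dif_pos exists_weakDeriv]
  exact exists_weakDeriv.choose_spec

theorem HasWeakDeriv.weakDeriv_ae_eq (hΩ : IsOpen Ω) {α : Fin m → Fin n}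
    (hg : HasWeakDeriv Ω α v g) : weakDeriv Ω α v =ᵐ[volume.restrict Ω] g :=
  hg.hasWeakDeriv_weakDeriv.ae_eq hΩ hg

/-- The weak gradient `∇ ⊗ ⋯ ⊗ ∇ v` of order `m` at a point: the tuple of all `n ^ m` ordered weak
derivatives. -/
noncomputable def weakGradient (m : ℕ) (Ω : Set (EucSpace n)) (v : EucSpace n → ℝ)
    (x : EucSpace n) : (Fin m → Fin n) → ℝ :=
  fun α => weakDeriv Ω α v x

theorem MemSobolev.hasWeakDeriv_weakGradient (hv : MemSobolev k p Ω v) (hm : m ≤ k)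
    (α : Fin m → Fin n) : HasWeakDeriv Ω α v fun x => weakGradient m Ω v x α :=
  have ⟨_, hg, _⟩ := hv.2 m hm α
  hg.hasWeakDeriv_weakDeriv

theorem MemSobolev.memLp_weakGradient (hv : MemSobolev k p Ω v) (hΩ : IsOpen Ω) (hm : m ≤ k)
    (α : Fin m → Fin n) : MemLp (fun x => weakGradient m Ω v x α) p (volume.restrict Ω) :=
  have ⟨_, hg, hg_memLp⟩ := hv.2 m hm α
  hg_memLp.ae_eq (hg.weakDeriv_ae_eq hΩ).symm

theorem MemSobolev.sobolevSeminorm_eq [Fact (1 ≤ p)] (hv : MemSobolev k p Ω v) (hΩ : IsOpen Ω) :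
    sobolevSeminorm k p Ω v =
      (eLpNorm (fun x => toLp p (weakGradient k Ω v x)) p (volume.restrict Ω)).toReal := by
  rw [toReal_eLpNorm_toLp fun α => hv.memLp_weakGradient hΩ le_rfl α, sobolevSeminorm]
  split_ifs with hp
  · subst hp
    simp only [PiLp.norm_eq_ciSup, Real.norm_of_nonneg ENNReal.toReal_nonneg, weakGradient]
  · have hp_pos : 0 < p.toReal :=
      ENNReal.toReal_pos (zero_lt_one.trans_le (Fact.out : 1 ≤ p)).ne' hp
    simp only [PiLp.norm_eq_sum hp_pos, Real.norm_of_nonneg ENNReal.toReal_nonneg, weakGradient]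

variable {A : Matrix (Fin n) (Fin n) ℝ}

theorem MemSobolev.comp_affineTransform (hv : MemSobolev k p Ω v) (hA : A.det ≠ 0)
    (b : EucSpace n) (hΩ : IsOpen Ω) :
    MemSobolev k p (affineTransform A b ⁻¹' Ω) (v ∘ affineTransform A b) :=
  ⟨memLp_comp_affineTransform hA b hv.1, fun _ hm β => ⟨_,
    HasWeakDeriv.comp_affineTransform hA b hΩ (hv.hasWeakDeriv_weakGradient hm) β,
    memLp_mulVec_apply _
      (fun α => memLp_comp_affineTransform hA b (hv.memLp_weakGradient hΩ hm α)) β⟩⟩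

theorem MemSobolev.weakGradient_comp_affineTransform (hv : MemSobolev k p Ω v) (hA : A.det ≠ 0)
    (b : EucSpace n) (hΩ : IsOpen Ω) :
    ∀ᵐ x ∂volume.restrict (affineTransform A b ⁻¹' Ω),
      weakGradient k (affineTransform A b ⁻¹' Ω) (v ∘ affineTransform A b) x =
        (kroneckerPow A k)ᵀ *ᵥ weakGradient k Ω v (affineTransform A b x) := by
  have hΩ' : IsOpen (affineTransform A b ⁻¹' Ω) :=
    hΩ.preimage (affineTransformHomeomorph A hA b).continuous
  filter_upwards [ae_all_iff.2 fun β => (HasWeakDeriv.comp_affineTransform hA b hΩ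
    (hv.hasWeakDeriv_weakGradient le_rfl) β).weakDeriv_ae_eq hΩ'] with x hx using funext hx

theorem norm_toLp_transpose_kroneckerPow_mulVec_le [Fact (1 ≤ p)] (A : Matrix (Fin n) (Fin n) ℝ)
    (x : (Fin k → Fin n) → ℝ) :
    ‖toLp p ((kroneckerPow A k)ᵀ *ᵥ x)‖ ≤
      (n : ℝ) ^ ((k : ℝ) * muExp p) * euclideanMatrixNorm A ^ k * ‖toLp p x‖ := by
  have norm_transpose : ‖(kroneckerPow A k)ᵀ‖ = ‖kroneckerPow A k‖ := by
    rw [← Matrix.conjTranspose_eq_transpose_of_trivial, Matrix.l2_opNorm_conjTranspose]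
  have card_rpow : (Fintype.card (Fin k → Fin n) : ℝ) ^ muExp p = (n : ℝ) ^ (k * muExp p) := by
    simp only [Fintype.card_fun, Fintype.card_fin, Nat.cast_pow]
    rw [← Real.rpow_natCast, ← Real.rpow_mul n.cast_nonneg]
  have norm_eq : ‖A‖ = euclideanMatrixNorm A := Matrix.cstar_norm_def A
  calc ‖toLp p ((kroneckerPow A k)ᵀ *ᵥ x)‖
      ≤ (n : ℝ) ^ (k * muExp p) * ‖kroneckerPow A k‖ * ‖toLp p x‖ := by
        simpa only [norm_transpose, card_rpow] using
          norm_toLp_mulVec_le (p := p) (kroneckerPow A k)ᵀ x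
    _ ≤ (n : ℝ) ^ (k * muExp p) * euclideanMatrixNorm A ^ k * ‖toLp p x‖ := by
        gcongr
        exact norm_eq ▸ l2_opNorm_kroneckerPow_le A k

theorem sobolevSeminorm_comp_affineTransform_le [Fact (1 ≤ p)] (hv : MemSobolev k p Ω v)
    (hA : A.det ≠ 0) (b : EucSpace n) (hΩ : IsOpen Ω) :
    sobolevSeminorm k p (affineTransform A b ⁻¹' Ω) (v ∘ affineTransform A b) ≤
      (n : ℝ) ^ ((k : ℝ) * muExp p) * euclideanMatrixNorm A ^ k *
        (|A.det|⁻¹ ^ p⁻¹.toReal * sobolevSeminorm k p Ω v) := by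
  set φ := affineTransform A b
  have hΩ' : IsOpen (φ ⁻¹' Ω) := hΩ.preimage (affineTransformHomeomorph A hA b).continuous
  set U : EucSpace n → PiLp p fun _ : Fin k → Fin n => ℝ := fun y => toLp p (weakGradient k Ω v y)
  have hU : MemLp U p (volume.restrict Ω) :=
    MemLp.of_eval_piLp (hv.memLp_weakGradient hΩ le_rfl)
  have norm_le : ∀ᵐ x ∂volume.restrict (φ ⁻¹' Ω),
      ‖toLp p (weakGradient k (φ ⁻¹' Ω) (v ∘ φ) x)‖ ≤
        (n : ℝ) ^ ((k : ℝ) * muExp p) * euclideanMatrixNorm A ^ k * ‖(U ∘ φ) x‖ := by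
    filter_upwards [hv.weakGradient_comp_affineTransform hA b hΩ] with x hx
    rw [hx]
    exact norm_toLp_transpose_kroneckerPow_mulVec_le A _
  have const_nonneg : 0 ≤ (n : ℝ) ^ ((k : ℝ) * muExp p) * euclideanMatrixNorm A ^ k :=
    mul_nonneg (by positivity) (pow_nonneg (norm_nonneg _) k)
  rw [(hv.comp_affineTransform hA b hΩ).sobolevSeminorm_eq hΩ', hv.sobolevSeminorm_eq hΩ]
  have eLpNorm_le := ENNReal.toReal_mono
    (ENNReal.mul_ne_top ENNReal.ofReal_ne_top (memLp_comp_affineTransform hA b hU).eLpNorm_ne_top)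
    (eLpNorm_le_mul_eLpNorm_of_ae_le_mul norm_le p)
  rwa [eLpNorm_comp_affineTransform hA, ENNReal.toReal_mul, ENNReal.toReal_mul,
    ENNReal.toReal_ofReal const_nonneg, ← ENNReal.toReal_rpow,
    ENNReal.toReal_ofReal (by positivity)] at eLpNorm_le

theorem sobolevSeminorm_le_comp_affineTransform [Fact (1 ≤ p)] (hv : MemSobolev k p Ω v)
    (hA : A.det ≠ 0) (b : EucSpace n) (hΩ : IsOpen Ω) :
    sobolevSeminorm k p Ω v ≤
      (n : ℝ) ^ ((k : ℝ) * muExp p) * euclideanMatrixNorm A⁻¹ ^ k * (|A.det| ^ p⁻¹.toReal *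
        sobolevSeminorm k p (affineTransform A b ⁻¹' Ω) (v ∘ affineTransform A b)) := by
  set φ := affineTransformHomeomorph A hA b
  have det_inv_ne_zero : A⁻¹.det ≠ 0 := (A.isUnit_nonsing_inv_det hA.isUnit).ne_zero
  have abs_det_inv : |A⁻¹.det|⁻¹ = |A.det| := by
    rw [Matrix.det_nonsing_inv, Ring.inverse_eq_inv', abs_inv, inv_inv]
  have h : sobolevSeminorm k p (φ.symm ⁻¹' (φ ⁻¹' Ω)) ((v ∘ φ) ∘ φ.symm) ≤ _ :=
    sobolevSeminorm_comp_affineTransform_le (hv.comp_affineTransform hA b hΩ) det_inv_ne_zero _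
      (hΩ.preimage φ.continuous)
  rwa [abs_det_inv, Function.comp_assoc, ← Set.preimage_comp, φ.self_comp_symm, Function.comp_id,
    Set.preimage_id] at h

end Sobolev

theorem muExp_eq_div {p : ℝ≥0∞} (hp0 : p ≠ 0) (hp_top : p ≠ ⊤) :
    muExp p = (tauExp p.toReal + gammaExp p.toReal) / p.toReal := by
  have hp_pos : 0 < p.toReal := ENNReal.toReal_pos hp0 hp_top
  have toReal_le_two : p.toReal ≤ 2 ↔ p ≤ 2 := by
    rw [← ENNReal.toReal_ofNat, ENNReal.toReal_le_toReal hp_top ENNReal.ofNat_ne_top]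
  simp only [muExp, tauExp, gammaExp, toReal_le_two, ENNReal.toReal_inv]
  split_ifs <;> field_simp <;> ring

theorem mainTheorem10 (n k : ℕ) (hn : 1 ≤ n) (p : ℝ≥0∞) (hp : 1 ≤ p)
    (A : Matrix (Fin n) (Fin n) ℝ) (hA : A.det ≠ 0) (b : EucSpace n)
    (Ω' Ω : Set (EucSpace n)) (hΩ' : IsOpen Ω') (hΩ : Ω = affineTransform A b '' Ω')
    (v : EucSpace n → ℝ) (hv : MemSobolev k p Ω v) :
    (p ≠ ⊤ → muExp p = (tauExp p.toReal + gammaExp p.toReal) / p.toReal) ∧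
    MemSobolev k p Ω' (v ∘ affineTransform A b) ∧
    (n : ℝ) ^ (-((k : ℝ) * muExp p)) * |A.det| ^ (p⁻¹).toReal *
        (euclideanMatrixNorm A ^ k)⁻¹ * sobolevSeminorm k p Ω' (v ∘ affineTransform A b)
      ≤ sobolevSeminorm k p Ω v ∧
    sobolevSeminorm k p Ω v
      ≤ (n : ℝ) ^ ((k : ℝ) * muExp p) * |A.det| ^ (p⁻¹).toReal *
        euclideanMatrixNorm A⁻¹ ^ k * sobolevSeminorm k p Ω' (v ∘ affineTransform A b) := by
  have : Fact (1 ≤ p) := ⟨hp⟩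
  set φ := affineTransformHomeomorph A hA b
  have isOpen_Ω : IsOpen Ω := hΩ ▸ φ.isOpenMap Ω' hΩ'
  obtain rfl : Ω' = affineTransform A b ⁻¹' Ω := hΩ ▸ (φ.preimage_image Ω').symm
  refine ⟨muExp_eq_div (zero_lt_one.trans_le hp).ne', hv.comp_affineTransform hA b isOpen_Ω,
    ?_, ?_⟩
  · have seminorm_nonneg : 0 ≤ sobolevSeminorm k p Ω v :=
      hv.sobolevSeminorm_eq isOpen_Ω ▸ ENNReal.toReal_nonneg
    have euclideanMatrixNorm_nonneg : 0 ≤ euclideanMatrixNorm A := norm_nonneg _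
    have lower := inv_mul_le_of_le_mul₀ (by positivity) seminorm_nonneg <|
      (sobolevSeminorm_comp_affineTransform_le hv hA b isOpen_Ω).trans_eq (mul_assoc _ _ _).symm
    rw [mul_inv, mul_inv, Real.inv_rpow (abs_nonneg _), inv_inv,
      ← Real.rpow_neg n.cast_nonneg] at lower
    exact lower.trans_eq' (by ring)
  · exact (sobolevSeminorm_le_comp_affineTransform hv hA b isOpen_Ω).trans_eq (by ring)
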